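/- Let $(X,\mathcal F,\mu)$ be a probability space, $T:X\to X$ an ergodic $\mu$-preserving transformation, $d\ge 2$ an integer, and let all function spaces have scalars $\mathbb K\in\{\mathbb R,\mathbb C\}$. Let $L_{d,\pi}(\mu^d)$ be the projective tensor product of $d$ copies of $L_d(\mu)$ (the completion of the algebraic tensor product in the projective norm). Let $J_d:L_{d,\pi}(\mu^d)\to L_d(\mu^d)$ and $D_d:L_{d,\pi}(\mu^d)\to L_1(\mu)$ be the continuous linear maps with $$J_d(g_1\otimes\cdots\otimes g_d)(x_1,\dots,x_d)=g_1(x_1)\cdots g_d(x_d),\qquad D_d(g_1\otimes\cdots\otimes g_d)(x)=g_1(x)\cdots g_d(x).$$ Put $Vg=g\circ T$ on $L_d(\mu)$, and for $\mathbf k=(k_1,\dots,k_d)\in\mathbb Z_+^d$ let $V^{\mathbf k}=V^{k_1}\otimes_\pi\cdots\otimes_\pi V^{k_d}$ on $L_{d,\pi}(\mu^d)$. Let $(e_k)_{k\ge 0}$ be a sequence in $L_d(\mu)$ with $e_0\equiv 1$ and, for every $k\ge 1$, $|e_k|_d=1$ and $\int_X e_k\,d\mu=0$. Suppose that $f\in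 L_d(\mu^d)$ admits the representation $$f(x_1,\dots,x_d)=\sum_{\mathbf k\in\mathbb Z_+^d}\lambda_{\mathbf k}\,e_{k_1}(x_1)\cdots e_{k_d}(x_d)\quad\text{for } \mu^d\text{-a.e. }(x_1,\dots,x_d),$$ with scalars $\lambda_{\mathbf k}$ satisfying $\sum_{\mathbf k}|\lambda_{\mathbf k}|<\infty$. Then $f$ belongs to $L_{d,\pi}(\mu^d)$, that is, $f=J_d u$ for some $u\in L_{d,\pi}(\mu^d)$; and for every $u\in L_{d,\pi}(\mu^d)$ with $J_d u=f$, $$\frac1{n^d}\sum_{0\le k_1,\dots,k_d\le n-1}D_dV^{(k_1,\dots,k_d)}u\ \longrightarrow\ \int_{X^d}f\,d\mu^d\qquad(n\to\infty)$$ $\mu$-almost surely and in the norm of $L_1(\mu)$. -/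

import Mathlib

open MeasureTheory Filter Topology
open scoped ENNReal TensorProduct

noncomputable section

namespace VonMises

variable {𝕜 : Type*} [RCLike 𝕜] {X : Type*} [MeasurableSpace X]

/-- The product probability space measure `μ^d` on `X^d`. -/
abbrev powMeasure (μ : Measure X) (d : ℕ) : Measure (Fin d → X) :=
  Measure.pi fun _ : Fin d => μ

/-- The `d`-th projective tensor power `L_{p,π}(μ^d)` of `L_p(μ)`: the completion of the algebraic
tensor power with respect to the projective norm (Mathlib's norm on `PiTensorProduct`). -/
abbrev ProjPower (𝕜 : Type*) [RCLike 𝕜] (p : ℝ≥0∞) [Fact (1 ≤ p)] (μ : Measure X) (d : ℕ) :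
    Type _ :=
  UniformSpace.Completion (⨂[𝕜] _ : Fin d, Lp 𝕜 p μ)

/-- The isometry `V g = g ∘ T` of `L_p(μ)`. -/
def koopman (𝕜 : Type*) [RCLike 𝕜] (p : ℝ≥0∞) [Fact (1 ≤ p)] {μ : Measure X} {T : X → X}
    (hT : MeasurePreserving T μ μ) : Lp 𝕜 p μ →L[𝕜] Lp 𝕜 p μ :=
  (Lp.compMeasurePreservingₗᵢ 𝕜 T hT).toContinuousLinearMap

/-- The operator `V^(k₁,…,k_d) = V^k₁ ⊗ ⋯ ⊗ V^k_d` on `L_{p,π}(μ^d)`. -/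
def koopmanPower (𝕜 : Type*) [RCLike 𝕜] (p : ℝ≥0∞) [Fact (1 ≤ p)] {μ : Measure X} {T : X → X}
    (hT : MeasurePreserving T μ μ) {d : ℕ} (k : Fin d → ℕ) :
    ProjPower 𝕜 p μ d →L[𝕜] ProjPower 𝕜 p μ d :=
  (PiTensorProduct.mapL fun i => koopman 𝕜 p hT ^ k i).completion

lemma one_le_of_fact (d : ℕ) [h : Fact (1 ≤ (d : ℝ≥0∞))] : 1 ≤ d := by
  exact_mod_cast h.out

section Embedding

variable {μ : Measure X} [IsProbabilityMeasure μ] {d : ℕ} [Fact (1 ≤ (d : ℝ≥0∞))]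

lemma memLp_prodFun (g : Fin d → Lp 𝕜 d μ) :
    MemLp (fun x : Fin d → X => ∏ i, g i (x i)) d (powMeasure μ d) := by
  have hd : (d : ℝ≥0∞) ≠ 0 := by have := one_le_of_fact d; simp; omega
  have hm : AEStronglyMeasurable (fun x : Fin d → X => ∏ i, g i (x i)) (powMeasure μ d) :=
    Finset.aestronglyMeasurable_fun_prod _ fun i _ =>
      (Lp.aestronglyMeasurable (g i)).comp_measurePreserving
        (measurePreserving_eval (fun _ : Fin d => μ) i)
  refine (integrable_norm_rpow_iff hm hd (by simp)).1 ?_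
  have h : ∀ i, Integrable (fun x => ‖g i x‖ ^ d) μ := fun i => by
    simpa using (Lp.memLp (g i)).integrable_norm_rpow hd (by simp)
  simpa [norm_prod, Finset.prod_pow] using Integrable.fintype_prod (μ := fun _ : Fin d => μ) h

lemma norm_prodFun (g : Fin d → Lp 𝕜 d μ) :
    ‖(memLp_prodFun g).toLp _‖ = ∏ i, ‖g i‖ := by
  have hd : (d : ℝ≥0∞) ≠ 0 := by have := one_le_of_fact d; simp; omega
  have h1 : ∀ i, ‖g i‖ = (∫ x, ‖g i x‖ ^ d ∂μ) ^ (d : ℝ)⁻¹ := fun i => by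
    rw [Lp.norm_def, (Lp.memLp (g i)).eLpNorm_eq_integral_rpow_norm hd (by simp),
      ENNReal.toReal_ofReal (by positivity)]
    simp
  rw [Lp.norm_toLp, (memLp_prodFun g).eLpNorm_eq_integral_rpow_norm hd (by simp),
    ENNReal.toReal_ofReal (by positivity), Finset.prod_congr rfl fun i _ => h1 i,
    Real.finsetProd_rpow _ _ (fun i _ => by positivity)]
  simp only [ENNReal.toReal_natCast, Real.rpow_natCast]
  congr 1
  rw [← integral_fintype_prod_eq_prod]
  simp [norm_prod, Finset.prod_pow]

/-- The multilinear map `(g₁,…,g_d) ↦ ((x₁,…,x_d) ↦ g₁(x₁)⋯g_d(x_d))` from `L_d(μ)^d` to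
`L_d(μ^d)`. -/
def prodMultilinear (𝕜 : Type*) [RCLike 𝕜] (μ : Measure X) [IsProbabilityMeasure μ] (d : ℕ)
    [Fact (1 ≤ (d : ℝ≥0∞))] :
    ContinuousMultilinearMap 𝕜 (fun _ : Fin d => Lp 𝕜 d μ) (Lp 𝕜 d (powMeasure μ d)) :=
  MultilinearMap.mkContinuous
    (MultilinearMap.mk' (fun g : Fin d → Lp 𝕜 d μ => (memLp_prodFun g).toLp _)
      (fun g i a b => by
        rw [← MemLp.toLp_add, MemLp.toLp_eq_toLp_iff]
        have hab := (measurePreserving_eval (fun _ : Fin d => μ) i).quasiMeasurePreserving.ae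
          (Lp.coeFn_add a b)
        filter_upwards [hab] with x hx
        have key : ∀ c : Lp 𝕜 d μ, (∏ j, (Function.update g i c j) (x j)) =
            MultilinearMap.mkPiAlgebra 𝕜 (Fin d) 𝕜
              (Function.update (fun j => g j (x j)) i (c (x i))) := fun c => by
          rw [MultilinearMap.mkPiAlgebra_apply]
          refine Finset.prod_congr rfl fun j _ => ?_
          exact Function.apply_update (fun j (h : Lp 𝕜 d μ) => h (x j)) g i c j
        have hx' : (a + b) (x i) = a (x i) + b (x i) := hx
        rw [Pi.add_apply, key, key, key, hx', MultilinearMap.map_update_add])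
      (fun g i c a => by
        rw [← MemLp.toLp_const_smul, MemLp.toLp_eq_toLp_iff]
        have hab := (measurePreserving_eval (fun _ : Fin d => μ) i).quasiMeasurePreserving.ae
          (Lp.coeFn_smul c a)
        filter_upwards [hab] with x hx
        have key : ∀ c : Lp 𝕜 d μ, (∏ j, (Function.update g i c j) (x j)) =
            MultilinearMap.mkPiAlgebra 𝕜 (Fin d) 𝕜
              (Function.update (fun j => g j (x j)) i (c (x i))) := fun c => by
          rw [MultilinearMap.mkPiAlgebra_apply]
          refine Finset.prod_congr rfl fun j _ => ?_
          exact Function.apply_update (fun j (h : Lp 𝕜 d μ) => h (x j)) g i c j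
        have hx' : (c • a) (x i) = c • a (x i) := hx
        rw [Pi.smul_apply, key, key, hx', MultilinearMap.map_update_smul]))
    1 (fun g => by
      rw [one_mul]
      exact (norm_prodFun g).le)

/-- The map `J_d : L_{d,π}(μ^d) → L_d(μ^d)`, the continuous linear map sending every elementary
tensor `g₁ ⊗ ⋯ ⊗ g_d` to the function `(x₁,…,x_d) ↦ g₁(x₁)⋯g_d(x_d)`. -/
def toKernel (𝕜 : Type*) [RCLike 𝕜] (μ : Measure X) [IsProbabilityMeasure μ] (d : ℕ)
    [Fact (1 ≤ (d : ℝ≥0∞))] : ProjPower 𝕜 d μ d →L[𝕜] Lp 𝕜 d (powMeasure μ d) :=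
  (PiTensorProduct.liftIsometry 𝕜 _ _ (prodMultilinear 𝕜 μ d)).fromCompletion

end Embedding

section Diagonal

variable {μ : Measure X} {d : ℕ} [Fact (1 ≤ (d : ℝ≥0∞))]

lemma memLp_diagFun (g : Fin d → Lp 𝕜 d μ) : MemLp (fun x => ∏ i, g i x) 1 μ := by
  have hd : (d : ℝ≥0∞) ≠ 0 := by have := one_le_of_fact d; simp; omega
  have := MemLp.prod' (s := Finset.univ) (p := fun _ : Fin d => (d : ℝ≥0∞))
    fun i _ => Lp.memLp (g i)
  rwa [show (∑ _ : Fin d, (d : ℝ≥0∞)⁻¹)⁻¹ = 1 by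
    simp [ENNReal.mul_inv_cancel hd (ENNReal.natCast_ne_top d)]] at this

lemma norm_diagFun_le (g : Fin d → Lp 𝕜 d μ) :
    ‖(memLp_diagFun g).toLp _‖ ≤ ∏ i, ‖g i‖ := by
  have hd' : (d : ℝ) ≠ 0 := by have := one_le_of_fact d; positivity
  have hd : (d : ℝ≥0∞) ≠ 0 := by have := one_le_of_fact d; simp; omega
  rw [Lp.norm_toLp]
  simp only [Lp.norm_def]
  rw [← ENNReal.toReal_prod]
  refine ENNReal.toReal_mono
    (ENNReal.prod_ne_top fun i _ => (Lp.memLp (g i)).eLpNorm_ne_top) ?_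
  rw [eLpNorm_one_eq_lintegral_enorm]
  have h := ENNReal.lintegral_prod_norm_pow_le (μ := μ) (Finset.univ : Finset (Fin d))
    (f := fun i x => ‖g i x‖ₑ ^ (d : ℝ))
    (fun i _ => (Lp.aestronglyMeasurable (g i)).enorm.pow_const _)
    (p := fun _ => (d : ℝ)⁻¹) (by simp [hd']) (fun _ _ => by positivity)
  have h2 : ∀ y : ℝ≥0∞, (y ^ (d : ℝ)) ^ (d : ℝ)⁻¹ = y := fun y => by
    rw [← ENNReal.rpow_mul, mul_inv_cancel₀ hd', ENNReal.rpow_one]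
  simp only [h2] at h
  calc ∫⁻ x, ‖∏ i, g i x‖ₑ ∂μ = ∫⁻ x, ∏ i, ‖g i x‖ₑ ∂μ := by simp [enorm_eq_nnnorm, nnnorm_prod]
    _ ≤ _ := h
    _ = ∏ i, eLpNorm (g i) d μ := by
      refine Finset.prod_congr rfl fun i _ => ?_
      rw [eLpNorm_eq_lintegral_rpow_enorm_toReal hd (by simp)]
      simp

/-- The multilinear map `(g₁,…,g_d) ↦ (x ↦ g₁(x)⋯g_d(x))` from `L_d(μ)^d` to `L_1(μ)`. -/
def diagMultilinear (𝕜 : Type*) [RCLike 𝕜] (μ : Measure X) (d : ℕ)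
    [Fact (1 ≤ (d : ℝ≥0∞))] :
    ContinuousMultilinearMap 𝕜 (fun _ : Fin d => Lp 𝕜 d μ) (Lp 𝕜 1 μ) :=
  MultilinearMap.mkContinuous
    (MultilinearMap.mk' (fun g : Fin d → Lp 𝕜 d μ => (memLp_diagFun g).toLp _)
      (fun g i a b => by
        rw [← MemLp.toLp_add, MemLp.toLp_eq_toLp_iff]
        filter_upwards [Lp.coeFn_add a b] with x hx
        have key : ∀ c : Lp 𝕜 d μ, (∏ j, (Function.update g i c j) x) =
            MultilinearMap.mkPiAlgebra 𝕜 (Fin d) 𝕜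
              (Function.update (fun j => g j x) i (c x)) := fun c => by
          rw [MultilinearMap.mkPiAlgebra_apply]
          refine Finset.prod_congr rfl fun j _ => ?_
          exact Function.apply_update (fun j (h : Lp 𝕜 d μ) => h x) g i c j
        have hx' : (a + b) x = a x + b x := hx
        rw [Pi.add_apply, key, key, key, hx', MultilinearMap.map_update_add])
      (fun g i c a => by
        rw [← MemLp.toLp_const_smul, MemLp.toLp_eq_toLp_iff]
        filter_upwards [Lp.coeFn_smul c a] with x hx
        have key : ∀ c : Lp 𝕜 d μ, (∏ j, (Function.update g i c j) x) =
            MultilinearMap.mkPiAlgebra 𝕜 (Fin d) 𝕜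
              (Function.update (fun j => g j x) i (c x)) := fun c => by
          rw [MultilinearMap.mkPiAlgebra_apply]
          refine Finset.prod_congr rfl fun j _ => ?_
          exact Function.apply_update (fun j (h : Lp 𝕜 d μ) => h x) g i c j
        have hx' : (c • a) x = c • a x := hx
        rw [Pi.smul_apply, key, key, hx', MultilinearMap.map_update_smul]))
    1 (fun g => by
      rw [one_mul]
      exact norm_diagFun_le g)

/-- The restriction operator to the diagonal `D_d : L_{d,π}(μ^d) → L_1(μ)`, the continuous linear
map sending every elementary tensor `g₁ ⊗ ⋯ ⊗ g_d` to the function `x ↦ g₁(x)⋯g_d(x)`. -/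
def diagRestrict (𝕜 : Type*) [RCLike 𝕜] (μ : Measure X) (d : ℕ)
    [Fact (1 ≤ (d : ℝ≥0∞))] : ProjPower 𝕜 d μ d →L[𝕜] Lp 𝕜 1 μ :=
  (PiTensorProduct.liftIsometry 𝕜 _ _ (diagMultilinear 𝕜 μ d)).fromCompletion

/-- The normalized von Mises statistic `n^{-d} ∑_{0 ≤ k₁,…,k_d ≤ n-1} D_d V^{(k₁,…,k_d)} u`. -/
def vonMisesAverage {T : X → X} (hT : MeasurePreserving T μ μ) (u : ProjPower 𝕜 d μ d) (n : ℕ) :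
    Lp 𝕜 1 μ :=
  ((n : 𝕜) ^ d)⁻¹ • ∑ k ∈ Fintype.piFinset fun _ : Fin d => Finset.range n,
    diagRestrict 𝕜 μ d (koopmanPower 𝕜 d hT k u)

end Diagonal

end VonMises

end

/-! For an elementary tensor the average over the cube `0 ≤ k₁,…,k_d < n` factors, by
multilinearity, into a product of `d` Birkhoff averages. By Birkhoff's theorem it tends almost
surely to the product of the means, which is the integral of the corresponding kernel.

Every `u` in the completed projective tensor power is an absolutely convergent series of elementary
tensors (`exists_hasSum_smul_tprod`), so it remains to interchange limit and sum. The series of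
products of maximal functions, `dominatingFun`, bounds all the averages at once. It is integrable by
Hölder's inequality and the strong type `(d,d)` maximal inequality `lintegral_birkhoffSup_rpow_le`,
which needs `d > 1`. Hence it is finite almost everywhere: dominated convergence for series gives
the almost sure limit, and dominated convergence for integrals gives the `L_1` limit.

The limit is the integral of `toKernel u`, so it depends on `u` only through its kernel. A preimage
of `f` exists because absolute summability of the coefficients makes the series of tensors `e_{k₁} ⊗
⋯ ⊗ e_{k_d}` converge in projective norm. -/

namespace VonMises

/-! ### Maximal inequalities and the pointwise ergodic theorem. -/

section Birkhoff

variable {X : Type*}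

/-- The maximum of the Birkhoff sums of `f` of length at most `N`. -/
def birkhoffMax (T : X → X) (f : X → ℝ) : ℕ → X → ℝ
  | 0 => fun _ => 0
  | N + 1 => fun x => max 0 (f x + birkhoffMax T f N (T x))

lemma birkhoffMax_nonneg (T : X → X) (f : X → ℝ) (N : ℕ) (x : X) : 0 ≤ birkhoffMax T f N x := by
  cases N <;> simp [birkhoffMax]

lemma birkhoffMax_le_succ (T : X → X) (f : X → ℝ) (N : ℕ) (x : X) :
    birkhoffMax T f N x ≤ birkhoffMax T f (N + 1) x := by
  induction N generalizing x with
  | zero => exact birkhoffMax_nonneg T f 1 x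
  | succ N ih => exact max_le_max le_rfl (by simpa using ih (T x))

lemma birkhoffSum_le_birkhoffMax (T : X → X) (f : X → ℝ) (N : ℕ) (x : X) :
    birkhoffSum T f N x ≤ birkhoffMax T f N x := by
  induction N generalizing x with
  | zero => simp [birkhoffMax]
  | succ N ih =>
    rw [birkhoffSum_succ']
    exact le_max_of_le_right (by simpa using ih (T x))

/-- Positivity rules out the empty sum, so the first term `f x` can be split off; monotonicity in
`N` restores the index. Garsia's proof of the maximal ergodic theorem integrates this inequality. -/
lemma birkhoffMax_le_of_pos {T : X → X} {f : X → ℝ} {N : ℕ} {x : X}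
    (h : 0 < birkhoffMax T f N x) : birkhoffMax T f N x ≤ f x + birkhoffMax T f N (T x) := by
  cases N with
  | zero => simp [birkhoffMax] at h
  | succ N =>
    have h1 : birkhoffMax T f (N + 1) x = f x + birkhoffMax T f N (T x) := by
      simp only [birkhoffMax] at h ⊢
      exact max_eq_right (by simpa using (lt_max_iff.1 h).resolve_left (lt_irrefl _) |>.le)
    rw [h1]
    simpa using birkhoffMax_le_succ T f N (T x)

lemma monotone_setOf_birkhoffMax_pos (T : X → X) (f : X → ℝ) :
    Monotone fun N => {x | 0 < birkhoffMax T f N x} :=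
  monotone_nat_of_le_succ fun N x hx => lt_of_lt_of_le hx (birkhoffMax_le_succ T f N x)

/-- The maximal function of the Birkhoff averages. -/
noncomputable def birkhoffSup (T : X → X) (g : X → ℝ) (x : X) : ℝ≥0∞ :=
  ⨆ n : ℕ, ENNReal.ofReal (birkhoffAverage ℝ T g n x)

lemma setOf_lt_birkhoffSup_subset (T : X → X) (g : X → ℝ) {t : ℝ} (ht : 0 ≤ t) :
    {x | ENNReal.ofReal t < birkhoffSup T g x} ⊆ {x | ∃ n : ℕ, n * t < birkhoffSum T g n x} := by
  intro x hx
  obtain ⟨n, hn⟩ := lt_iSup_iff.1 (show ENNReal.ofReal t < ⨆ _, _ from hx)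
  refine ⟨n, ?_⟩
  have h := ((ENNReal.ofReal_lt_ofReal_iff_of_nonneg ht).1 hn)
  rcases Nat.eq_zero_or_pos n with rfl | hn0
  · simp at h
    linarith
  · have hn' : (0 : ℝ) < n := by exact_mod_cast hn0
    rw [birkhoffAverage, smul_eq_mul, lt_inv_mul_iff₀ hn'] at h
    exact h

lemma enorm_birkhoffAverage_le {𝕜 : Type*} [RCLike 𝕜] (T : X → X) (g : X → 𝕜) (n : ℕ) (x : X) :
    ‖birkhoffAverage 𝕜 T g n x‖ₑ ≤ birkhoffSup T (fun y => ‖g y‖) x := by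
  refine le_trans ?_ (le_iSup
    (fun n => ENNReal.ofReal (birkhoffAverage ℝ T (fun y => ‖g y‖) n x)) n)
  rw [← ofReal_norm]
  refine ENNReal.ofReal_le_ofReal ?_
  rw [birkhoffAverage, birkhoffAverage, norm_smul, norm_inv, RCLike.norm_natCast, smul_eq_mul]
  exact mul_le_mul_of_nonneg_left (norm_sum_le _ _) (by positivity)

variable [MeasurableSpace X] {μ : Measure X} {T : X → X}

lemma measurable_birkhoffMax (hT : Measurable T) {f : X → ℝ} (hf : Measurable f) (N : ℕ) :
    Measurable (birkhoffMax T f N) := by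
  induction N with
  | zero => exact measurable_const
  | succ N ih => exact measurable_const.max (hf.add (ih.comp hT))

lemma integrable_birkhoffMax (hT : MeasurePreserving T μ μ) {f : X → ℝ} (hf : Integrable f μ)
    (N : ℕ) : Integrable (birkhoffMax T f N) μ := by
  induction N with
  | zero => exact integrable_zero _ _ _
  | succ N ih => exact (integrable_zero _ _ _).sup (hf.add (hT.integrable_comp_of_integrable ih))

/-- The maximal ergodic theorem. -/
lemma setIntegral_birkhoffMax_pos_nonneg (hT : MeasurePreserving T μ μ) {f : X → ℝ}
    (hfm : Measurable f) (hf : Integrable f μ) (N : ℕ) :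
    0 ≤ ∫ x in {x | 0 < birkhoffMax T f N x}, f x ∂μ := by
  have hm := measurable_birkhoffMax hT.measurable hfm N
  have hi := integrable_birkhoffMax hT hf N
  have hiT : Integrable (fun x => birkhoffMax T f N (T x)) μ := hT.integrable_comp_of_integrable hi
  have hs : MeasurableSet {x | 0 < birkhoffMax T f N x} := measurableSet_lt measurable_const hm
  -- The maximum vanishes off the set, so restricting to the set leaves its integral unchanged,
  -- while it can only decrease that of its composition with `T`. Both full integrals agree by
  -- invariance, so the difference has nonnegative integral over the set.
  have h1 : ∫ x in {x | 0 < birkhoffMax T f N x}, birkhoffMax T f N x ∂μ =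
      ∫ x, birkhoffMax T f N x ∂μ :=
    setIntegral_eq_integral_of_forall_compl_eq_zero fun x hx =>
      le_antisymm (not_lt.1 hx) (birkhoffMax_nonneg T f N x)
  have h2 : ∫ x in {x | 0 < birkhoffMax T f N x}, birkhoffMax T f N (T x) ∂μ ≤
      ∫ x, birkhoffMax T f N (T x) ∂μ :=
    setIntegral_le_integral hiT (Eventually.of_forall fun x => birkhoffMax_nonneg T f N (T x))
  have h3 : ∫ x, birkhoffMax T f N (T x) ∂μ = ∫ x, birkhoffMax T f N x ∂μ := by
    conv_rhs => rw [← hT.map_eq]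
    exact (integral_map hT.aemeasurable hm.aestronglyMeasurable).symm
  have h4 : ∫ x in {x | 0 < birkhoffMax T f N x},
      (birkhoffMax T f N x - birkhoffMax T f N (T x)) ∂μ ≤
      ∫ x in {x | 0 < birkhoffMax T f N x}, f x ∂μ :=
    setIntegral_mono_on (hi.sub hiT).integrableOn hf.integrableOn hs fun x hx => by
      linarith [birkhoffMax_le_of_pos hx]
  rw [integral_sub hi.integrableOn hiT.integrableOn] at h4
  linarith

/-- The weak type `(1,1)` maximal inequality for Birkhoff averages. -/
lemma mul_measure_birkhoffSum_gt_le [IsFiniteMeasure μ] (hT : MeasurePreserving T μ μ) {g : X → ℝ}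
    (hgm : Measurable g) (hg : Integrable g μ) (hg0 : 0 ≤ g) {t : ℝ} (ht : 0 < t) :
    ENNReal.ofReal t * μ {x | ∃ n : ℕ, n * t < birkhoffSum T g n x} ≤
      ∫⁻ x, ENNReal.ofReal (g x) ∂μ := by
  -- An average of `g` exceeds `t` exactly when a nonempty Birkhoff sum of `g - t` is positive.
  set f : X → ℝ := fun x => g x - t with hf
  have hfm : Measurable f := hgm.sub_const t
  have hfi : Integrable f μ := hg.sub (integrable_const t)
  have hsum : ∀ n x, birkhoffSum T f n x = birkhoffSum T g n x - n * t := fun n x => by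
    simp [birkhoffSum, hf, Finset.sum_sub_distrib]
  have hsub : {x | ∃ n : ℕ, n * t < birkhoffSum T g n x} ⊆
      ⋃ N, {x | 0 < birkhoffMax T f N x} := by
    rintro x ⟨n, hn⟩
    refine Set.mem_iUnion.2 ⟨n, lt_of_lt_of_le ?_ (birkhoffSum_le_birkhoffMax T f n x)⟩
    rw [hsum]
    linarith
  refine (mul_le_mul_right (measure_mono hsub) _).trans ?_
  rw [(monotone_setOf_birkhoffMax_pos T f).measure_iUnion, ENNReal.mul_iSup]
  refine iSup_le fun N => ?_
  have h := setIntegral_birkhoffMax_pos_nonneg hT hfm hfi N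
  rw [integral_sub hg.integrableOn (integrable_const t), setIntegral_const, smul_eq_mul] at h
  have h2 := setIntegral_le_integral (s := {x | 0 < birkhoffMax T f N x}) hg
    (Eventually.of_forall hg0)
  rw [← ofReal_integral_eq_lintegral_ofReal hg (Eventually.of_forall hg0),
    ← ofReal_measureReal, ← ENNReal.ofReal_mul ht.le]
  exact ENNReal.ofReal_le_ofReal (by linarith)

lemma measurable_birkhoffSum (hT : Measurable T) {g : X → ℝ} (hg : Measurable g) (n : ℕ) :
    Measurable (birkhoffSum T g n) :=
  Finset.measurable_sum _ fun k _ => hg.comp (hT.iterate k)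

lemma measurable_birkhoffSup (hT : Measurable T) {g : X → ℝ} (hg : Measurable g) :
    Measurable (birkhoffSup T g) :=
  Measurable.iSup fun n => ((measurable_birkhoffSum hT hg n).const_smul (n : ℝ)⁻¹).ennreal_ofReal

lemma birkhoffSup_ae_lt_top [IsFiniteMeasure μ] (hT : MeasurePreserving T μ μ) {g : X → ℝ}
    (hgm : Measurable g) (hg : Integrable g μ) (hg0 : 0 ≤ g) :
    ∀ᵐ x ∂μ, birkhoffSup T g x < ∞ := by
  set C := ∫⁻ x, ENNReal.ofReal (g x) ∂μ with hC
  have hCtop : C ≠ ∞ := by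
    rw [hC, ← ofReal_integral_eq_lintegral_ofReal hg (Eventually.of_forall hg0)]
    exact ENNReal.ofReal_ne_top
  -- The weak type inequality at every level `n` forces the set where the maximal function is
  -- infinite to be null.
  have key : ∀ n : ℕ, n * μ {x | birkhoffSup T g x = ∞} ≤ C := fun n => by
    rcases Nat.eq_zero_or_pos n with rfl | hn
    · simp
    · have h := mul_measure_birkhoffSum_gt_le hT hgm hg hg0 (t := n) (by exact_mod_cast hn)
      rw [ENNReal.ofReal_natCast] at h
      refine (mul_le_mul_right (measure_mono fun x hx => ?_) _).trans h
      refine setOf_lt_birkhoffSup_subset T g (Nat.cast_nonneg n) ?_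
      have hx : birkhoffSup T g x = ∞ := hx
      simp [hx]
  have h0 : μ {x | birkhoffSup T g x = ∞} = 0 := by
    by_contra h
    obtain ⟨n, hn⟩ := ENNReal.exists_nat_mul_gt h hCtop
    exact absurd (key n) (not_le.2 hn)
  filter_upwards [measure_eq_zero_iff_ae_notMem.1 h0] with x hx
  exact lt_top_iff_ne_top.2 hx

/-- The weak type maximal inequality, localized to the set where `g` is large. -/
lemma mul_measure_birkhoffSum_gt_le_setLIntegral [IsFiniteMeasure μ] (hT : MeasurePreserving T μ μ)
    {g : X → ℝ} (hgm : Measurable g) (hg : Integrable g μ) (hg0 : 0 ≤ g) {t : ℝ} (ht : 0 < t) :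
    ENNReal.ofReal t * μ {x | ∃ n : ℕ, n * t < birkhoffSum T g n x} ≤
      2 * ∫⁻ x in {x | t < 2 * g x}, ENNReal.ofReal (g x) ∂μ := by
  set s := {x | t < 2 * g x} with hs_def
  have hs : MeasurableSet s := measurableSet_lt measurable_const (hgm.const_mul 2)
  -- The part of `g` below `t / 2` contributes at most `t / 2` to any average, so the truncation
  -- must exceed level `t / 2`; this halving produces the factor 2.
  have hle : ∀ x, g x ≤ s.indicator g x + t / 2 := fun x => by
    by_cases hx : x ∈ s
    · rw [Set.indicator_of_mem hx]; linarith
    · rw [Set.indicator_of_notMem hx]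
      have : ¬ t < 2 * g x := hx
      linarith
  have h := mul_measure_birkhoffSum_gt_le hT (hgm.indicator hs) (hg.indicator hs)
    (Set.indicator_nonneg fun x _ => hg0 x) (half_pos ht)
  have hsub : {x | ∃ n : ℕ, n * t < birkhoffSum T g n x} ⊆
      {x | ∃ n : ℕ, n * (t / 2) < birkhoffSum T (s.indicator g) n x} := by
    rintro x ⟨n, hn⟩
    refine ⟨n, ?_⟩
    have : birkhoffSum T g n x ≤ birkhoffSum T (s.indicator g) n x + n * (t / 2) := by
      refine (Finset.sum_le_sum fun k _ => hle (T^[k] x)).trans ?_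
      simp [birkhoffSum, Finset.sum_add_distrib]
    linarith
  have ht2 : ENNReal.ofReal t = 2 * ENNReal.ofReal (t / 2) := by
    rw [show (2 : ℝ≥0∞) = ENNReal.ofReal 2 by simp, ← ENNReal.ofReal_mul (by norm_num)]
    congr 1; ring
  rw [ht2, mul_assoc]
  refine mul_le_mul_right ((mul_le_mul_right (measure_mono hsub) _).trans (h.trans_eq ?_)) 2
  rw [← lintegral_indicator hs]
  refine lintegral_congr fun x => ?_
  by_cases hx : x ∈ s <;> simp [hx]

/-- The strong type `(p,p)` maximal inequality for Birkhoff averages. -/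
lemma lintegral_birkhoffSup_rpow_le [IsFiniteMeasure μ] (hT : MeasurePreserving T μ μ)
    {g : X → ℝ} (hgm : Measurable g) (hg : Integrable g μ) (hg0 : 0 ≤ g) {p : ℝ} (hp : 1 < p) :
    ∫⁻ x, birkhoffSup T g x ^ p ∂μ ≤
      ENNReal.ofReal (2 ^ p * p / (p - 1)) * ∫⁻ x, ENNReal.ofReal (g x) ^ p ∂μ := by
  have hp0 : 0 < p := by linarith
  have hp1 : 0 < p - 1 := by linarith
  have hM := measurable_birkhoffSup hT.measurable hgm
  -- With density `g`, the localized integral in the weak inequality becomes `ν {t < 2 g}`. The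
  -- layer cake formula for `μ` with exponent `p` then reduces to the one for `ν` with exponent `p -
  -- 1`.
  set ν := μ.withDensity fun x => ENNReal.ofReal (g x) with hν
  have hweak : ∀ t : ℝ, 0 < t → μ {x | t < (birkhoffSup T g x).toReal} *
      ENNReal.ofReal (t ^ (p - 1)) ≤
      2 * (ν {x | t < 2 * g x} * ENNReal.ofReal (t ^ (p - 1 - 1))) := fun t ht => by
    have h1 : μ {x | t < (birkhoffSup T g x).toReal} ≤
        μ {x | ∃ n : ℕ, n * t < birkhoffSum T g n x} :=
      measure_mono (Set.Subset.trans (fun x hx => ENNReal.ofReal_lt_iff_lt_toReal ht.le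
        (fun h => by simp [h] at hx; linarith) |>.2 hx) (setOf_lt_birkhoffSup_subset T g ht.le))
    have h2 := mul_measure_birkhoffSum_gt_le_setLIntegral hT hgm hg hg0 ht
    rw [← withDensity_apply _ (measurableSet_lt measurable_const (hgm.const_mul 2))] at h2
    have h3 : ENNReal.ofReal (t ^ (p - 1)) =
        ENNReal.ofReal t * ENNReal.ofReal (t ^ (p - 1 - 1)) := by
      rw [← ENNReal.ofReal_mul ht.le, Real.rpow_sub_one ht.ne' (p - 1), mul_div_cancel₀ _ ht.ne']
    calc μ {x | t < (birkhoffSup T g x).toReal} * ENNReal.ofReal (t ^ (p - 1))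
        ≤ μ {x | ∃ n : ℕ, n * t < birkhoffSum T g n x} * ENNReal.ofReal (t ^ (p - 1)) := by gcongr
      _ = ENNReal.ofReal t * μ {x | ∃ n : ℕ, n * t < birkhoffSum T g n x} *
          ENNReal.ofReal (t ^ (p - 1 - 1)) := by rw [h3]; ring
      _ ≤ (2 * ν {x | t < 2 * g x}) * ENNReal.ofReal (t ^ (p - 1 - 1)) := by gcongr
      _ = _ := by ring
  have hL : ∫⁻ x, birkhoffSup T g x ^ p ∂μ =
      ∫⁻ x, ENNReal.ofReal ((birkhoffSup T g x).toReal ^ p) ∂μ := by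
    refine lintegral_congr_ae ?_
    filter_upwards [birkhoffSup_ae_lt_top hT hgm hg hg0] with x hx
    rw [← ENNReal.ofReal_rpow_of_nonneg ENNReal.toReal_nonneg hp0.le, ENNReal.ofReal_toReal hx.ne]
  have hR : ∫⁻ x, ENNReal.ofReal ((2 * g x) ^ (p - 1)) ∂ν =
      ENNReal.ofReal (2 ^ (p - 1)) * ∫⁻ x, ENNReal.ofReal (g x) ^ p ∂μ := by
    rw [hν, lintegral_withDensity_eq_lintegral_mul _ hgm.ennreal_ofReal
      (by fun_prop), ← lintegral_const_mul _ (by fun_prop)]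
    refine lintegral_congr fun x => ?_
    have hx : 0 ≤ g x := hg0 x
    rw [Pi.mul_apply, ENNReal.ofReal_rpow_of_nonneg hx hp0.le, ← ENNReal.ofReal_mul hx,
      ← ENNReal.ofReal_mul (by positivity), Real.mul_rpow (by norm_num) hx]
    congr 1
    have : g x ^ p = g x ^ (p - 1) * g x := by
      rcases hx.eq_or_lt with h | h
      · rw [← h, Real.zero_rpow hp0.ne', mul_zero]
      · rw [Real.rpow_sub_one h.ne', div_mul_cancel₀ _ h.ne']
    rw [this]; ring
  have e1 := lintegral_rpow_eq_lintegral_meas_lt_mul μ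
    (Eventually.of_forall fun x => (ENNReal.toReal_nonneg : 0 ≤ (birkhoffSup T g x).toReal))
    hM.ennreal_toReal.aemeasurable hp0
  have e2 := lintegral_rpow_eq_lintegral_meas_lt_mul ν
    (Eventually.of_forall fun x => (by have := hg0 x; simp at this; simpa : 0 ≤ 2 * g x))
    (hgm.const_mul 2).aemeasurable hp1
  have e3 : ∫⁻ t in Set.Ioi (0 : ℝ), ν {x | t < 2 * g x} * ENNReal.ofReal (t ^ (p - 1 - 1)) =
      ENNReal.ofReal (p - 1)⁻¹ * (ENNReal.ofReal (2 ^ (p - 1)) *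
        ∫⁻ x, ENNReal.ofReal (g x) ^ p ∂μ) := by
    rw [← hR, e2, ← mul_assoc, ← ENNReal.ofReal_mul (by positivity), inv_mul_cancel₀ hp1.ne']
    simp
  calc ∫⁻ x, birkhoffSup T g x ^ p ∂μ
      = ENNReal.ofReal p * ∫⁻ t in Set.Ioi (0 : ℝ), μ {x | t < (birkhoffSup T g x).toReal} *
        ENNReal.ofReal (t ^ (p - 1)) := by rw [hL, e1]
    _ ≤ ENNReal.ofReal p * ∫⁻ t in Set.Ioi (0 : ℝ),
        2 * (ν {x | t < 2 * g x} * ENNReal.ofReal (t ^ (p - 1 - 1))) :=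
      mul_le_mul_right (setLIntegral_mono' measurableSet_Ioi hweak) _
    _ = ENNReal.ofReal p * (2 * (ENNReal.ofReal (p - 1)⁻¹ * (ENNReal.ofReal (2 ^ (p - 1)) *
        ∫⁻ x, ENNReal.ofReal (g x) ^ p ∂μ))) := by
      rw [lintegral_const_mul' _ _ (by norm_num), e3]
    _ = ENNReal.ofReal (2 ^ p * p / (p - 1)) * ∫⁻ x, ENNReal.ofReal (g x) ^ p ∂μ := by
      rw [show (2 : ℝ≥0∞) = ENNReal.ofReal 2 by simp]
      simp only [← mul_assoc]
      rw [← ENNReal.ofReal_mul (by positivity), ← ENNReal.ofReal_mul (by positivity),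
        ← ENNReal.ofReal_mul (by positivity)]
      congr 2
      rw [Real.rpow_sub_one (by norm_num)]
      field_simp

/-- Boundedness of the sums is a `T`-invariant property, so by ergodicity it holds almost everywhere
or almost nowhere. In the latter case the sets `{0 < birkhoffMax T f N}` exhaust the space, and the
maximal ergodic theorem yields `0 ≤ ∫ f` in the limit. -/
lemma ae_bddAbove_birkhoffSum_sub [IsProbabilityMeasure μ] (hT : Ergodic T μ) {f : X → ℝ}
    (hfm : Measurable f) (hf : Integrable f μ) (hneg : ∫ x, f x ∂μ < 0) :
    ∀ᵐ x ∂μ, BddAbove (Set.range fun n => birkhoffSum T f n x) := by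
  set E := {x | BddAbove (Set.range fun n => birkhoffSum T f n x)} with hE_def
  have hE : MeasurableSet E :=
    measurableSet_bddAbove_range fun n => measurable_birkhoffSum hT.measurable hfm n
  have hinv : T ⁻¹' E = E := by
    ext x
    constructor
    · rintro ⟨K, hK⟩
      refine ⟨max 0 (f x + K), ?_⟩
      rintro _ ⟨n, rfl⟩
      cases n with
      | zero => simp
      | succ n =>
        have := hK ⟨n, rfl⟩
        simp only [birkhoffSum_succ']
        exact le_max_of_le_right (by simpa using this)
    · rintro ⟨K, hK⟩
      refine ⟨K - f x, ?_⟩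
      rintro _ ⟨n, rfl⟩
      have := hK ⟨n + 1, rfl⟩
      simp only [birkhoffSum_succ'] at this
      simp only
      linarith
  rcases hT.toPreErgodic.ae_empty_or_univ hE hinv with h | h
  · exfalso
    have hfull : (⋃ N, {x | 0 < birkhoffMax T f N x}) =ᵐ[μ] Set.univ := by
      filter_upwards [h] with x hx
      have hx' : ¬ x ∈ E := fun hxE => by
        have : (x ∈ E) = False := hx
        rwa [this] at hxE
      refine eq_true ?_
      by_contra hcon
      refine hx' ⟨0, ?_⟩
      rintro _ ⟨n, rfl⟩
      refine (birkhoffSum_le_birkhoffMax T f n x).trans (not_lt.1 fun hlt => hcon ?_)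
      exact Set.mem_iUnion.2 ⟨n, hlt⟩
    have hlim := tendsto_setIntegral_of_monotone (μ := μ) (f := f)
      (fun N => measurableSet_lt measurable_const (measurable_birkhoffMax hT.measurable hfm N))
      (monotone_setOf_birkhoffMax_pos T f) hf.integrableOn
    rw [setIntegral_congr_set hfull, setIntegral_univ] at hlim
    exact absurd (ge_of_tendsto' hlim
      (setIntegral_birkhoffMax_pos_nonneg hT.toMeasurePreserving hfm hf)) (not_le.2 hneg)
  · filter_upwards [h] with x hx
    exact of_eq_true hx

lemma ae_eventually_birkhoffAverage_le [IsProbabilityMeasure μ] (hT : Ergodic T μ) {g : X → ℝ}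
    (hgm : Measurable g) (hg : Integrable g μ) {ε : ℝ} (hε : 0 < ε) :
    ∀ᵐ x ∂μ, ∀ᶠ n in atTop, birkhoffAverage ℝ T g n x < ∫ y, g y ∂μ + ε := by
  -- Centering at half the tolerance gives `g - c` negative mean. Its sums stay below some `K`, so
  -- the averages of `g` are at most `c + K / n`, and `K / n` falls below the other half.
  set c := ∫ y, g y ∂μ + ε / 2 with hc
  have h := ae_bddAbove_birkhoffSum_sub hT (hgm.sub_const c) (hg.sub (integrable_const c))
    (by rw [integral_sub hg (integrable_const c)]; simp [hc, hε])
  filter_upwards [h] with x hx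
  obtain ⟨K, hK⟩ := hx
  obtain ⟨N, hN⟩ := exists_nat_gt (K / (ε / 2))
  filter_upwards [eventually_ge_atTop N, eventually_gt_atTop 0] with n hn hn0
  have hn' : (0 : ℝ) < n := by exact_mod_cast hn0
  have h1 := hK ⟨n, rfl⟩
  have h2 : birkhoffSum T (fun x => g x - c) n x = birkhoffSum T g n x - n * c := by
    simp [birkhoffSum, Finset.sum_sub_distrib]
  simp only [h2] at h1
  have h3 : K < n * (ε / 2) := by
    rw [div_lt_iff₀ (by positivity)] at hN
    refine hN.trans_le ?_
    gcongr
  rw [birkhoffAverage, smul_eq_mul, inv_mul_lt_iff₀ hn']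
  have : n * (∫ y, g y ∂μ + ε) = n * c + n * (ε / 2) := by rw [hc]; ring
  linarith

lemma ae_tendsto_birkhoffAverage_real [IsProbabilityMeasure μ] (hT : Ergodic T μ) {g : X → ℝ}
    (hg : Integrable g μ) :
    ∀ᵐ x ∂μ, Tendsto (fun n => birkhoffAverage ℝ T g n x) atTop (𝓝 (∫ y, g y ∂μ)) := by
  wlog hgm : Measurable g generalizing g
  · have h := this (hg.congr hg.aestronglyMeasurable.ae_eq_mk)
      hg.aestronglyMeasurable.stronglyMeasurable_mk.measurable
    have h' : ∀ᵐ x ∂μ, ∀ n, birkhoffAverage ℝ T g n x =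
        birkhoffAverage ℝ T (hg.aestronglyMeasurable.mk g) n x := ae_all_iff.2 fun n =>
      hT.quasiMeasurePreserving.birkhoffAverage_ae_eq_of_ae_eq ℝ
        hg.aestronglyMeasurable.ae_eq_mk n
    filter_upwards [h, h'] with x hx hx'
    rw [integral_congr_ae hg.aestronglyMeasurable.ae_eq_mk]
    exact hx.congr fun n => (hx' n).symm
  have hup : ∀ᵐ x ∂μ, ∀ m : ℕ, ∀ᶠ n in atTop,
      birkhoffAverage ℝ T g n x < ∫ y, g y ∂μ + 1 / ((m : ℝ) + 1) :=
    ae_all_iff.2 fun m => ae_eventually_birkhoffAverage_le hT hgm hg (by positivity)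
  -- Lower bounds come from `-g`; countably many tolerances keep the exceptional set null.
  have hlow : ∀ᵐ x ∂μ, ∀ m : ℕ, ∀ᶠ n in atTop,
      birkhoffAverage ℝ T (-g) n x < ∫ y, (-g) y ∂μ + 1 / ((m : ℝ) + 1) :=
    ae_all_iff.2 fun m => ae_eventually_birkhoffAverage_le hT hgm.neg hg.neg (by positivity)
  filter_upwards [hup, hlow] with x h1 h2
  refine tendsto_order.2 ⟨fun a ha => ?_, fun a ha => ?_⟩
  · obtain ⟨m, hm⟩ := exists_nat_one_div_lt (sub_pos.2 ha)
    filter_upwards [h2 m] with n hn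
    simp only [birkhoffAverage_neg, Pi.neg_apply, integral_neg] at hn
    linarith
  · obtain ⟨m, hm⟩ := exists_nat_one_div_lt (sub_pos.2 ha)
    filter_upwards [h1 m] with n hn
    linarith

/-- The pointwise ergodic theorem of Birkhoff for ergodic transformations. -/
theorem ae_tendsto_birkhoffAverage {𝕜 : Type*} [RCLike 𝕜] [IsProbabilityMeasure μ]
    (hT : Ergodic T μ) {g : X → 𝕜} (hg : Integrable g μ) :
    ∀ᵐ x ∂μ, Tendsto (fun n => birkhoffAverage 𝕜 T g n x) atTop (𝓝 (∫ y, g y ∂μ)) := by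
  filter_upwards [ae_tendsto_birkhoffAverage_real hT hg.re,
    ae_tendsto_birkhoffAverage_real hT hg.im] with x h1 h2
  have h := ((RCLike.continuous_ofReal (K := 𝕜)).tendsto _ |>.comp h1).add
    (((RCLike.continuous_ofReal (K := 𝕜)).tendsto _ |>.comp h2).mul_const RCLike.I)
  rw [integral_re_add_im hg] at h
  refine h.congr fun n => ?_
  rw [birkhoffAverage_congr_ring 𝕜 ℝ]
  have h3 := map_birkhoffAverage ℝ ℝ (RCLike.reLm (K := 𝕜)) T g n x
  have h4 := map_birkhoffAverage ℝ ℝ (RCLike.imLm (K := 𝕜)) T g n x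
  rw [← RCLike.re_add_im (birkhoffAverage ℝ T g n x)]
  exact congrArg₂ (· + ·) (congrArg _ h3.symm) (congrArg (· * _) (congrArg _ h4.symm))

end Birkhoff

/-! ### Series representation in the completed projective tensor product. -/

section Tensor

variable {𝕜 : Type*} [RCLike 𝕜] {ι : Type*} [Fintype ι] {E : ι → Type*}
  [∀ i, NormedAddCommGroup (E i)] [∀ i, NormedSpace 𝕜 (E i)]

lemma norm_smul_coe_tprod_le (c : 𝕜) (g : Π i, E i) :
    ‖c • ((⨂ₜ[𝕜] i, g i : ⨂[𝕜] i, E i) : UniformSpace.Completion (⨂[𝕜] i, E i))‖ ≤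
      ‖c‖ * ∏ i, ‖g i‖ := by
  rw [norm_smul, UniformSpace.Completion.norm_coe]
  exact mul_le_mul_of_nonneg_left (PiTensorProduct.projectiveSeminorm_tprod_le g) (norm_nonneg c)

/-- Every element of the completed projective tensor product is the sum of an absolutely convergent
series of elementary tensors. -/
lemma exists_hasSum_smul_tprod (u : UniformSpace.Completion (⨂[𝕜] i, E i)) :
    ∃ (l : ℕ → ℕ) (c : (Σ m, Fin (l m)) → 𝕜) (g : (Σ m, Fin (l m)) → Π i, E i),
      Summable (fun j => ‖c j‖ * ∏ i, ‖g j i‖) ∧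
      HasSum (fun j => c j •
        ((⨂ₜ[𝕜] i, g j i : ⨂[𝕜] i, E i) : UniformSpace.Completion (⨂[𝕜] i, E i))) u := by
  have hu : u ∈ closure ((UniformSpace.Completion.toCompl
      (α := ⨂[𝕜] i, E i)).range : Set (UniformSpace.Completion (⨂[𝕜] i, E i))) :=
    UniformSpace.Completion.denseRange_coe u
  obtain ⟨v, hv, hvs, -, hvn⟩ := controlled_sum_of_mem_closure hu
    (b := fun m => (1 / 2 : ℝ) ^ m) (fun m => by positivity)
  choose w hw using fun m => hvs m
  have hw' : ∀ m, (w m : UniformSpace.Completion (⨂[𝕜] i, E i)) = v m := hw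
  -- Each `w m` gets a representation within `2⁻ᵐ` of the infimum defining its projective norm, so
  -- the total cost stays summable.
  have hp : ∀ m, ∃ p : PiTensorProduct.lifts (w m),
      PiTensorProduct.projectiveSeminormAux p.1 < ‖w m‖ + (1 / 2 : ℝ) ^ m := fun m =>
    exists_lt_of_ciInf_lt (by
      rw [← PiTensorProduct.norm_def]
      exact lt_add_of_pos_right _ (by positivity))
  choose p hp using hp
  have hgeom : Summable fun m : ℕ => (1 / 2 : ℝ) ^ m := summable_geometric_two
  have hwn : Summable fun m => ‖w m‖ := by
    -- The geometric bound on `v m` holds only for `m > 0`, hence the shift.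
    refine (summable_nat_add_iff 1).1 (Summable.of_nonneg_of_le (fun m => norm_nonneg _)
      (fun m => ?_) ((summable_nat_add_iff 1).2 hgeom))
    rw [← UniformSpace.Completion.norm_coe, hw']
    exact (hvn (m + 1) m.succ_pos).le
  let l : ℕ → ℕ := fun m => (p m).1.toList.length
  let c : (Σ m, Fin (l m)) → 𝕜 := fun j => ((p j.1).1.toList[j.2]).1
  let g : (Σ m, Fin (l m)) → Π i, E i := fun j => ((p j.1).1.toList[j.2]).2
  have hsum : Summable (fun j => ‖c j‖ * ∏ i, ‖g j i‖) := by
    refine (summable_sigma_of_nonneg fun j => by positivity).2 ⟨fun m => Summable.of_finite, ?_⟩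
    refine Summable.of_nonneg_of_le (fun m => tsum_nonneg fun _ => by positivity) (fun m => ?_)
      (hwn.add hgeom)
    refine le_trans (le_of_eq ?_) (hp m).le
    rw [tsum_fintype]
    exact Fin.sum_univ_fun_getElem (p m).1.toList fun q => ‖q.1‖ * ∏ i, ‖q.2 i‖
  refine ⟨l, c, g, hsum, ?_⟩
  have hs := (Summable.of_norm_bounded hsum fun j => norm_smul_coe_tprod_le (c j) (g j)).hasSum
  have h1 : HasSum (fun m => (w m : UniformSpace.Completion (⨂[𝕜] i, E i))) _ :=
    hs.sigma fun m => by
      have h := hasSum_fintype fun k : Fin (l m) => c ⟨m, k⟩ •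
        ((⨂ₜ[𝕜] i, g ⟨m, k⟩ i : ⨂[𝕜] i, E i) : UniformSpace.Completion (⨂[𝕜] i, E i))
      convert h using 1
      have h2 := (PiTensorProduct.mem_lifts_iff (w m) (p m).1).1 (p m).2
      rw [← Fin.sum_univ_fun_getElem] at h2
      have h3 := congrArg (UniformSpace.Completion.toComplL (𝕜 := 𝕜)) h2
      rw [map_sum] at h3
      exact (h3.symm.trans (Finset.sum_congr rfl fun k _ => map_smul _ _ _))
  -- Grouping by `m` recovers the partial sums of `v` over `range (n + 1)`, so the two limits
  -- coincide.
  have h2 := (tendsto_add_atTop_iff_nat 1).2 h1.tendsto_sum_nat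
  simp only [hw'] at h2
  rwa [tendsto_nhds_unique h2 hv] at hs

end Tensor

/-! ### Series and integration in `L_p`. -/

section LpSum

variable {𝕜 : Type*} [RCLike 𝕜] {α : Type*} [MeasurableSpace α] {ν : Measure α} {p : ℝ≥0∞}
  [Fact (1 ≤ p)]

/-- The sum of a series in `L_p` agrees with its pointwise sum. -/
lemma ae_eq_of_hasSum {ι : Type*} [Countable ι] {F : ι → Lp 𝕜 p ν} {G : Lp 𝕜 p ν} {h : α → 𝕜}
    (hF : HasSum F G) (hh : ∀ᵐ x ∂ν, HasSum (fun j => F j x) (h x)) : G =ᵐ[ν] h := by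
  -- Norm convergence gives almost everywhere convergence along a subsequence only, which suffices
  -- because the pointwise sum is already known to exist.
  obtain ⟨s, hs⟩ := exists_seq_tendsto (atTop : Filter (Finset ι))
  obtain ⟨φ, hφ, hlim⟩ := (tendstoInMeasure_of_tendsto_Lp (hF.comp hs)).exists_seq_tendsto_ae
  have hcoe : ∀ᵐ x ∂ν, ∀ n, (∑ j ∈ s n, F j : Lp 𝕜 p ν) x = ∑ j ∈ s n, F j x :=
    ae_all_iff.2 fun n => by
      filter_upwards [Lp.coeFn_finsetSum (s n) F] with x hx
      rw [hx, Finset.sum_apply]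
  filter_upwards [hlim, hh, hcoe] with x h1 h2 h3
  refine tendsto_nhds_unique h1 (((h2.comp hs).comp hφ.tendsto_atTop).congr fun n => ?_)
  exact (h3 (φ n)).symm

/-- Integration as a continuous linear functional on `L_p` of a probability space. -/
noncomputable def integralLp (𝕜 : Type*) [RCLike 𝕜] (p : ℝ≥0∞) [Fact (1 ≤ p)] (ν : Measure α)
    [IsProbabilityMeasure ν] : Lp 𝕜 p ν →L[𝕜] 𝕜 :=
  LinearMap.mkContinuous
    { toFun := fun F => ∫ x, F x ∂ν
      map_add' := fun F G => by
        rw [integral_congr_ae (Lp.coeFn_add F G)]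
        exact integral_add ((Lp.memLp F).integrable Fact.out) ((Lp.memLp G).integrable Fact.out)
      map_smul' := fun c F => by
        rw [integral_congr_ae (Lp.coeFn_smul c F)]
        exact integral_const_mul c _ }
    1 (fun F => by
      rw [one_mul, Lp.norm_def]
      refine (norm_integral_le_lintegral_norm _).trans ?_
      refine ENNReal.toReal_mono (Lp.eLpNorm_ne_top F) ?_
      simp only [ofReal_norm]
      rw [← eLpNorm_one_eq_lintegral_enorm]
      exact eLpNorm_le_eLpNorm_of_exponent_le Fact.out (Lp.aestronglyMeasurable F))

lemma integralLp_apply [IsProbabilityMeasure ν] (F : Lp 𝕜 p ν) :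
    integralLp 𝕜 p ν F = ∫ x, F x ∂ν := rfl

end LpSum

/-! ### Von Mises averages of elementary tensors and their maximal bound. -/

section Koopman

variable {𝕜 : Type*} [RCLike 𝕜] {X : Type*} [MeasurableSpace X] {μ : Measure X} {T : X → X}

lemma koopman_pow_ae_eq {p : ℝ≥0∞} [Fact (1 ≤ p)] (hT : MeasurePreserving T μ μ) (k : ℕ)
    (g : Lp 𝕜 p μ) : (koopman 𝕜 p hT ^ k) g =ᵐ[μ] fun x => g (T^[k] x) := by
  induction k with
  | zero => simp
  | succ k ih =>
    rw [pow_succ']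
    have h1 : (koopman 𝕜 p hT) ((koopman 𝕜 p hT ^ k) g) =ᵐ[μ] ((koopman 𝕜 p hT ^ k) g) ∘ T :=
      Lp.coeFn_compMeasurePreserving _ hT
    filter_upwards [h1, hT.quasiMeasurePreserving.ae ih] with x hx hx'
    rw [mul_apply_eq_comp, hx, Function.comp_apply, hx', Function.iterate_succ_apply]

/-- The ergodic averages `n⁻¹ ∑_{k < n} V^k` as operators on `L_p`. -/
noncomputable def koopmanAvg {p : ℝ≥0∞} [Fact (1 ≤ p)] (hT : MeasurePreserving T μ μ) (n : ℕ)
    (g : Lp 𝕜 p μ) : Lp 𝕜 p μ :=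
  (n : 𝕜)⁻¹ • ∑ k ∈ Finset.range n, (koopman 𝕜 p hT ^ k) g

lemma koopmanAvg_ae_eq {p : ℝ≥0∞} [Fact (1 ≤ p)] (hT : MeasurePreserving T μ μ) (n : ℕ)
    (g : Lp 𝕜 p μ) : koopmanAvg hT n g =ᵐ[μ] birkhoffAverage 𝕜 T g n := by
  have h : ∀ᵐ x ∂μ, ∀ k, (koopman 𝕜 p hT ^ k) g x = g (T^[k] x) :=
    ae_all_iff.2 fun k => koopman_pow_ae_eq hT k g
  filter_upwards [h, Lp.coeFn_smul (n : 𝕜)⁻¹ (∑ k ∈ Finset.range n, (koopman 𝕜 p hT ^ k) g),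
    Lp.coeFn_finsetSum (Finset.range n) fun k => (koopman 𝕜 p hT ^ k) g] with x h1 h2 h3
  rw [koopmanAvg, h2, Pi.smul_apply, h3, Finset.sum_apply, birkhoffAverage, birkhoffSum]
  simp only [h1]

variable {d : ℕ} [Fact (1 ≤ (d : ℝ≥0∞))]

/-- The normalized von Mises statistic as a continuous linear map. -/
noncomputable def vonMisesAverageL (𝕜 : Type*) [RCLike 𝕜] (d : ℕ) [Fact (1 ≤ (d : ℝ≥0∞))]
    (hT : MeasurePreserving T μ μ) (n : ℕ) : ProjPower 𝕜 d μ d →L[𝕜] Lp 𝕜 1 μ :=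
  ((n : 𝕜) ^ d)⁻¹ • ∑ k ∈ Fintype.piFinset fun _ : Fin d => Finset.range n,
    (diagRestrict 𝕜 μ d).comp (koopmanPower 𝕜 d hT k)

lemma vonMisesAverageL_apply (hT : MeasurePreserving T μ μ) (n : ℕ) (u : ProjPower 𝕜 d μ d) :
    vonMisesAverageL 𝕜 d hT n u = vonMisesAverage hT u n := by
  simp [vonMisesAverageL, vonMisesAverage]

/-- Expanding a product of `d` one-parameter averages by multilinearity gives the sum over the whole
cube with weight `n⁻ᵈ`. -/
lemma vonMisesAverageL_tprod (hT : MeasurePreserving T μ μ) (n : ℕ) (g : Fin d → Lp 𝕜 d μ) :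
    vonMisesAverageL 𝕜 d hT n ((⨂ₜ[𝕜] i, g i : ⨂[𝕜] _ : Fin d, Lp 𝕜 d μ) : ProjPower 𝕜 d μ d) =
      (memLp_diagFun fun i => koopmanAvg hT n (g i)).toLp _ := by
  have h1 : ∀ k : Fin d → ℕ, diagRestrict 𝕜 μ d (koopmanPower 𝕜 d hT k
      ((⨂ₜ[𝕜] i, g i : ⨂[𝕜] _ : Fin d, Lp 𝕜 d μ) : ProjPower 𝕜 d μ d)) =
      diagMultilinear 𝕜 μ d fun i => (koopman 𝕜 d hT ^ k i) (g i) := fun k => by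
    rw [koopmanPower, ContinuousLinearMap.completion_apply_coe, PiTensorProduct.mapL_apply,
      PiTensorProduct.map_tprod, diagRestrict, ContinuousLinearMap.fromCompletion_apply_coe,
      PiTensorProduct.liftIsometry_apply_apply, PiTensorProduct.lift.tprod]
    rfl
  have h2 : (memLp_diagFun fun i => koopmanAvg hT n (g i)).toLp _ =
      diagMultilinear 𝕜 μ d fun i => koopmanAvg hT n (g i) := rfl
  rw [vonMisesAverageL_apply, vonMisesAverage, h2]
  simp only [h1, koopmanAvg]
  rw [ContinuousMultilinearMap.map_smul_univ, ContinuousMultilinearMap.map_sum_finset]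
  simp

lemma toKernel_tprod [IsProbabilityMeasure μ] (g : Fin d → Lp 𝕜 d μ) :
    toKernel 𝕜 μ d ((⨂ₜ[𝕜] i, g i : ⨂[𝕜] _ : Fin d, Lp 𝕜 d μ) : ProjPower 𝕜 d μ d) =
      (memLp_prodFun g).toLp _ := by
  rw [toKernel, ContinuousLinearMap.fromCompletion_apply_coe,
      PiTensorProduct.liftIsometry_apply_apply, PiTensorProduct.lift.tprod]
  rfl

lemma integral_toKernel_tprod [IsProbabilityMeasure μ] (g : Fin d → Lp 𝕜 d μ) :
    integralLp 𝕜 d (powMeasure μ d) (toKernel 𝕜 μ d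
      ((⨂ₜ[𝕜] i, g i : ⨂[𝕜] _ : Fin d, Lp 𝕜 d μ) : ProjPower 𝕜 d μ d)) =
      ∏ i, ∫ x, g i x ∂μ := by
  rw [toKernel_tprod, integralLp_apply, integral_congr_ae (MemLp.coeFn_toLp _)]
  exact integral_fintype_prod_eq_prod (μ := fun _ => μ) fun i x => g i x

lemma vonMisesAverage_smul_tprod_ae_eq (hT : MeasurePreserving T μ μ) (n : ℕ) (c : 𝕜)
    (g : Fin d → Lp 𝕜 d μ) :
    vonMisesAverageL 𝕜 d hT n
      (c • ((⨂ₜ[𝕜] i, g i : ⨂[𝕜] _ : Fin d, Lp 𝕜 d μ) : ProjPower 𝕜 d μ d)) =ᵐ[μ]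
      fun x => c * ∏ i, birkhoffAverage 𝕜 T (g i) n x := by
  rw [map_smul, vonMisesAverageL_tprod]
  have h : ∀ᵐ x ∂μ, ∀ i, koopmanAvg hT n (g i) x = birkhoffAverage 𝕜 T (g i) n x :=
    ae_all_iff.2 fun i => koopmanAvg_ae_eq hT n (g i)
  filter_upwards [h, Lp.coeFn_smul c ((memLp_diagFun fun i => koopmanAvg hT n (g i)).toLp _),
    (memLp_diagFun fun i => koopmanAvg hT n (g i)).coeFn_toLp] with x h1 h2 h3
  rw [h2, Pi.smul_apply, h3, smul_eq_mul]
  simp only [h1]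

/-- The product of the maximal functions of `d` elements of `L_d` is integrable. -/
lemma lintegral_prod_birkhoffSup_le [IsFiniteMeasure μ] (hT : MeasurePreserving T μ μ) (hd : 2 ≤ d)
    (g : Fin d → Lp 𝕜 d μ) :
    ∫⁻ x, ∏ i, birkhoffSup T (fun y => ‖g i y‖) x ∂μ ≤
      ENNReal.ofReal (2 ^ d * d / (d - 1)) * ∏ i, ‖g i‖ₑ := by
  have hd1 : (1 : ℝ) < d := by exact_mod_cast hd
  have hd0 : (d : ℝ) ≠ 0 := by positivity
  have hdE : (d : ℝ≥0∞) ≠ 0 := by simp; omega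
  have hgm : ∀ i, Measurable fun y => ‖g i y‖ := fun i =>
    (Lp.stronglyMeasurable (g i)).norm.measurable
  have hM : ∀ i, Measurable (birkhoffSup T fun y => ‖g i y‖) := fun i =>
    measurable_birkhoffSup hT.measurable (hgm i)
  -- Hölder's inequality with `d` weights `1 / d`, followed by the maximal inequality with exponent
  -- `d` in each factor; the `d` constants `C ^ (1 / d)` multiply back to `C`.
  have h := ENNReal.lintegral_prod_norm_pow_le (μ := μ) (Finset.univ : Finset (Fin d))
    (f := fun i x => birkhoffSup T (fun y => ‖g i y‖) x ^ (d : ℝ))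
    (fun i _ => ((hM i).pow_const _).aemeasurable)
    (p := fun _ => (d : ℝ)⁻¹) (by simp [hd0]) (fun _ _ => by positivity)
  have h2 : ∀ y : ℝ≥0∞, (y ^ (d : ℝ)) ^ (d : ℝ)⁻¹ = y := fun y => by
    rw [← ENNReal.rpow_mul, mul_inv_cancel₀ hd0, ENNReal.rpow_one]
  have h3 : ∀ y : ℝ≥0∞, (y ^ (d : ℝ)⁻¹) ^ (d : ℝ) = y := fun y => by
    rw [← ENNReal.rpow_mul, inv_mul_cancel₀ hd0, ENNReal.rpow_one]
  simp only [h2] at h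
  refine h.trans ?_
  set C := ENNReal.ofReal (2 ^ d * d / (d - 1)) with hC
  have hi : ∀ i, (∫⁻ x, birkhoffSup T (fun y => ‖g i y‖) x ^ (d : ℝ) ∂μ) ^ (d : ℝ)⁻¹ ≤
      C ^ (d : ℝ)⁻¹ * ‖g i‖ₑ := fun i => by
    have hb := lintegral_birkhoffSup_rpow_le hT (hgm i)
      ((Lp.memLp (g i)).integrable Fact.out).norm (fun _ => norm_nonneg _) hd1
    rw [Real.rpow_natCast] at hb
    refine (ENNReal.rpow_le_rpow hb (by positivity)).trans_eq ?_
    rw [ENNReal.mul_rpow_of_nonneg _ _ (by positivity)]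
    congr 1
    rw [Lp.enorm_def, eLpNorm_eq_lintegral_rpow_enorm_toReal hdE (by simp)]
    simp
  refine (Finset.prod_le_prod' fun i _ => hi i).trans_eq ?_
  rw [Finset.prod_mul_distrib, Finset.prod_const, Finset.card_univ, Fintype.card_fin,
    ← ENNReal.rpow_natCast, h3]

end Koopman

/-! ### The dominating function. -/

section Domination

variable {𝕜 : Type*} [RCLike 𝕜] {X : Type*} [MeasurableSpace X] {μ : Measure X} {T : X → X}
  {p : ℝ≥0∞} {d : ℕ} {ι : Type*}

/-- A dominating function for the von Mises statistics of an absolutely convergent series of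
elementary tensors. -/
noncomputable def dominatingFun (T : X → X) (c : ι → 𝕜) (g : ι → Fin d → Lp 𝕜 p μ)
    (x : X) : ℝ≥0∞ :=
  ∑' j, ‖c j‖ₑ * ∏ i, birkhoffSup T (fun y => ‖g j i y‖) x

lemma enorm_mul_prod_birkhoffAverage_le (T : X → X) (c : ι → 𝕜) (g : ι → Fin d → Lp 𝕜 p μ)
    (j : ι) (n : ℕ) (x : X) :
    ‖c j * ∏ i, birkhoffAverage 𝕜 T (g j i) n x‖ₑ ≤
      ‖c j‖ₑ * ∏ i, birkhoffSup T (fun y => ‖g j i y‖) x := by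
  have h : ‖∏ i, birkhoffAverage 𝕜 T (g j i) n x‖ₑ = ∏ i, ‖birkhoffAverage 𝕜 T (g j i) n x‖ₑ := by
    simp [enorm_eq_nnnorm, nnnorm_prod]
  rw [enorm_mul, h]
  exact mul_le_mul_right (Finset.prod_le_prod' fun i _ => enorm_birkhoffAverage_le T _ n x) _

lemma measurable_dominatingFun [Countable ι] (hT : Measurable T) (c : ι → 𝕜)
    (g : ι → Fin d → Lp 𝕜 p μ) : Measurable (dominatingFun T c g) :=
  Measurable.tsum fun j => (Finset.measurable_fun_prod _ fun i _ =>
    measurable_birkhoffSup hT (Lp.stronglyMeasurable (g j i)).norm.measurable).const_mul _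

end Domination

/-! ### Passage to the limit and existence of a preimage. -/

section Main

variable {𝕜 : Type*} [RCLike 𝕜] {X : Type*} [MeasurableSpace X] {μ : Measure X} {T : X → X}
  [IsProbabilityMeasure μ] {d : ℕ} [Fact (1 ≤ (d : ℝ≥0∞))]

/-- The integral of the kernel of an absolutely convergent series of elementary tensors. -/
lemma hasSum_integral_toKernel {ι : Type*} {c : ι → 𝕜} {g : ι → Fin d → Lp 𝕜 d μ}
    {u : ProjPower 𝕜 d μ d}
    (hu : HasSum (fun j => c j •
      ((⨂ₜ[𝕜] i, g j i : ⨂[𝕜] _ : Fin d, Lp 𝕜 d μ) : ProjPower 𝕜 d μ d)) u) :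
    HasSum (fun j => c j * ∏ i, ∫ x, g j i x ∂μ)
      (∫ y, toKernel 𝕜 μ d u y ∂powMeasure μ d) := by
  have h := ((integralLp 𝕜 d (powMeasure μ d)).comp (toKernel 𝕜 μ d)).hasSum hu
  rw [ContinuousLinearMap.comp_apply, integralLp_apply] at h
  refine h.congr_fun fun j => ?_
  rw [ContinuousLinearMap.comp_apply, map_smul, map_smul, integral_toKernel_tprod, smul_eq_mul]

variable {ι : Type*} [Countable ι] {c : ι → 𝕜} {g : ι → Fin d → Lp 𝕜 d μ}

/-- By Tonelli the integral is taken term by term, and the maximal bound has one constant valid for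
all `j`. -/
lemma lintegral_dominatingFun_ne_top (hT : MeasurePreserving T μ μ) (hd : 2 ≤ d)
    (hs : Summable fun j => ‖c j‖ * ∏ i, ‖g j i‖) :
    ∫⁻ x, dominatingFun T c g x ∂μ ≠ ∞ := by
  have hM : ∀ j, Measurable fun x => ∏ i, birkhoffSup T (fun y => ‖g j i y‖) x := fun j =>
    Finset.measurable_fun_prod _ fun i _ => measurable_birkhoffSup hT.measurable
      (Lp.stronglyMeasurable (g j i)).norm.measurable
  simp only [dominatingFun]
  rw [lintegral_tsum fun j => ((hM j).const_mul _).aemeasurable]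
  refine ne_top_of_le_ne_top (b := ENNReal.ofReal (2 ^ d * d / (d - 1)) *
    ∑' j, ‖c j‖ₑ * ∏ i, ‖g j i‖ₑ) (ENNReal.mul_ne_top ENNReal.ofReal_ne_top ?_) ?_
  · have h := hs.tsum_ofReal_ne_top
    refine ne_of_eq_of_ne (tsum_congr fun j => ?_) h
    rw [ENNReal.ofReal_mul (norm_nonneg _), ENNReal.ofReal_prod_of_nonneg fun _ _ => norm_nonneg _]
    simp
  · rw [← ENNReal.tsum_mul_left]
    refine ENNReal.tsum_le_tsum fun j => ?_
    rw [lintegral_const_mul _ (hM j), mul_left_comm]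
    exact mul_le_mul_right (lintegral_prod_birkhoffSup_le hT hd (g j)) _

/-- The ergodic theorem for von Mises statistics of absolutely convergent series of elementary
tensors. -/
lemma tendsto_vonMisesAverage_of_hasSum (hT : Ergodic T μ) (hd : 2 ≤ d)
    (hs : Summable fun j => ‖c j‖ * ∏ i, ‖g j i‖) {u : ProjPower 𝕜 d μ d}
    (hu : HasSum (fun j => c j •
      ((⨂ₜ[𝕜] i, g j i : ⨂[𝕜] _ : Fin d, Lp 𝕜 d μ) : ProjPower 𝕜 d μ d)) u) :
    (∀ᵐ x ∂μ, Tendsto (fun n : ℕ => vonMisesAverage hT.toMeasurePreserving u n x) atTop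
      (𝓝 (∫ y, toKernel 𝕜 μ d u y ∂powMeasure μ d))) ∧
    Tendsto (fun n : ℕ => vonMisesAverage hT.toMeasurePreserving u n) atTop
      (𝓝 (Lp.const 1 μ (∫ y, toKernel 𝕜 μ d u y ∂powMeasure μ d))) := by
  have hT' := hT.toMeasurePreserving
  set I := ∫ y, toKernel 𝕜 μ d u y ∂powMeasure μ d with hI
  have hHfin := lintegral_dominatingFun_ne_top hT' hd hs
  have hHm : Measurable (dominatingFun T c g) := measurable_dominatingFun hT.measurable c g
  have hH : ∀ᵐ x ∂μ, dominatingFun T c g x < ∞ := ae_lt_top hHm hHfin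
  have hbound : ∀ x, dominatingFun T c g x < ∞ →
      Summable fun j => (‖c j‖ₑ * ∏ i, birkhoffSup T (fun y => ‖g j i y‖) x).toReal :=
    fun x hx => ENNReal.summable_toReal hx.ne
  have hle : ∀ x, dominatingFun T c g x < ∞ → ∀ n j,
      ‖c j * ∏ i, birkhoffAverage 𝕜 T (g j i) n x‖ ≤
        (‖c j‖ₑ * ∏ i, birkhoffSup T (fun y => ‖g j i y‖) x).toReal := fun x hx n j => by
    rw [← toReal_enorm]
    exact ENNReal.toReal_mono (ENNReal.ne_top_of_tsum_ne_top hx.ne j)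
      (enorm_mul_prod_birkhoffAverage_le T c g j n x)
  -- The series for the average converges a priori only in `L_1`; domination makes it converge
  -- pointwise as well, so the two sums agree.
  have hvm : ∀ᵐ x ∂μ, ∀ n, vonMisesAverage hT' u n x =
      ∑' j, c j * ∏ i, birkhoffAverage 𝕜 T (g j i) n x := by
    refine ae_all_iff.2 fun n => ?_
    have hL := (vonMisesAverageL 𝕜 d hT' n).hasSum hu
    rw [vonMisesAverageL_apply] at hL
    refine ae_eq_of_hasSum hL ?_
    have hj : ∀ᵐ x ∂μ, ∀ j, vonMisesAverageL 𝕜 d hT' n (c j •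
        ((⨂ₜ[𝕜] i, g j i : ⨂[𝕜] _ : Fin d, Lp 𝕜 d μ) : ProjPower 𝕜 d μ d)) x =
        c j * ∏ i, birkhoffAverage 𝕜 T (g j i) n x :=
      ae_all_iff.2 fun j => vonMisesAverage_smul_tprod_ae_eq hT' n (c j) (g j)
    filter_upwards [hH, hj] with x hx hxj
    simp only [hxj]
    exact (Summable.of_norm_bounded (hbound x hx) (hle x hx n)).hasSum
  have hvle : ∀ᵐ x ∂μ, ∀ n, ‖vonMisesAverage hT' u n x‖ₑ ≤ dominatingFun T c g x := by
    filter_upwards [hvm] with x hx n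
    rw [hx]
    exact enorm_tsum_le_tsum_enorm.trans
      (ENNReal.tsum_le_tsum fun j => enorm_mul_prod_birkhoffAverage_le T c g j n x)
  have hbirk : ∀ᵐ x ∂μ, ∀ j i, Tendsto (fun n => birkhoffAverage 𝕜 T (g j i) n x) atTop
      (𝓝 (∫ y, g j i y ∂μ)) :=
    ae_all_iff.2 fun j => ae_all_iff.2 fun i =>
      ae_tendsto_birkhoffAverage hT ((Lp.memLp (g j i)).integrable Fact.out)
  have hae : ∀ᵐ x ∂μ, Tendsto (fun n : ℕ => vonMisesAverage hT' u n x) atTop (𝓝 I) := by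
    filter_upwards [hH, hvm, hbirk] with x hx hxv hxb
    simp only [hxv]
    rw [hI, ← (hasSum_integral_toKernel hu).tsum_eq]
    exact tendsto_tsum_of_dominated_convergence (hbound x hx)
      (fun j => (tendsto_finsetProd _ fun i _ => hxb j i).const_mul (c j))
      (Eventually.of_forall fun n j => hle x hx n j)
  refine ⟨hae, ?_⟩
  rw [Lp.tendsto_Lp_iff_tendsto_eLpNorm']
  have hdiff : ∀ n, eLpNorm (⇑(vonMisesAverage hT' u n) - ⇑(Lp.const 1 μ I)) 1 μ =
      ∫⁻ x, ‖vonMisesAverage hT' u n x - I‖ₑ ∂μ := fun n => by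
    rw [eLpNorm_one_eq_lintegral_enorm]
    refine lintegral_congr_ae ?_
    filter_upwards [Lp.coeFn_const 1 μ I] with x hx
    rw [Pi.sub_apply, hx, Function.const_apply]
  simp only [hdiff]
  -- The dominating function bounds every average and the constant `‖I‖ₑ` bounds the limit.
  have hlim := tendsto_lintegral_of_dominated_convergence' (μ := μ)
    (F := fun n x => ‖vonMisesAverage hT' u n x - I‖ₑ) (f := fun _ => 0)
    (fun x => dominatingFun T c g x + ‖I‖ₑ)
    (fun n => ((Lp.aestronglyMeasurable _).sub aestronglyMeasurable_const).enorm)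
    (fun n => by
      filter_upwards [hvle] with x hx
      exact (enorm_sub_le).trans (by gcongr; exact hx n))
    (by
      rw [lintegral_add_right _ measurable_const, lintegral_const]
      exact ENNReal.add_ne_top.2 ⟨hHfin, by simp⟩)
    (by
      filter_upwards [hae] with x hx
      simpa using (hx.sub_const I).enorm)
  simpa using hlim

/-- The ergodic theorem for von Mises statistics of arbitrary elements of the projective tensor
power. -/
theorem tendsto_vonMisesAverage (hT : Ergodic T μ) (hd : 2 ≤ d) (u : ProjPower 𝕜 d μ d) :
    (∀ᵐ x ∂μ, Tendsto (fun n : ℕ => vonMisesAverage hT.toMeasurePreserving u n x) atTop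
      (𝓝 (∫ y, toKernel 𝕜 μ d u y ∂powMeasure μ d))) ∧
    Tendsto (fun n : ℕ => vonMisesAverage hT.toMeasurePreserving u n) atTop
      (𝓝 (Lp.const 1 μ (∫ y, toKernel 𝕜 μ d u y ∂powMeasure μ d))) := by
  obtain ⟨l, c, g, hs, hu⟩ := exists_hasSum_smul_tprod u
  exact tendsto_vonMisesAverage_of_hasSum hT hd hs hu

/-- A kernel that is almost everywhere the sum of an absolutely convergent series of products comes
from the projective tensor power. -/
lemma exists_toKernel_eq (hs : Summable fun j => ‖c j‖ * ∏ i, ‖g j i‖)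
    {f : Lp 𝕜 d (powMeasure μ d)}
    (hf : ∀ᵐ x ∂powMeasure μ d, HasSum (fun j => c j * ∏ i, g j i (x i)) (f x)) :
    ∃ u : ProjPower 𝕜 d μ d, toKernel 𝕜 μ d u = f := by
  have hu := (Summable.of_norm_bounded hs fun j => norm_smul_coe_tprod_le (c j) (g j)).hasSum
  refine ⟨_, Lp.ext (ae_eq_of_hasSum ((toKernel 𝕜 μ d).hasSum hu) ?_)⟩
  have hj : ∀ᵐ x ∂powMeasure μ d, ∀ j, toKernel 𝕜 μ d (c j •
      ((⨂ₜ[𝕜] i, g j i : ⨂[𝕜] _ : Fin d, Lp 𝕜 d μ) : ProjPower 𝕜 d μ d)) x =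
      c j * ∏ i, g j i (x i) := ae_all_iff.2 fun j => by
    rw [map_smul, toKernel_tprod]
    filter_upwards [Lp.coeFn_smul (c j) ((memLp_prodFun (g j)).toLp _),
      (memLp_prodFun (g j)).coeFn_toLp] with x h1 h2
    rw [h1, Pi.smul_apply, h2, smul_eq_mul]
  filter_upwards [hf, hj] with x h1 h2
  exact h1.congr_fun h2

end Main

end VonMises

theorem mainTheorem11 {𝕜 : Type*} [RCLike 𝕜] {X : Type*} [MeasurableSpace X]
    (μ : Measure X) [IsProbabilityMeasure μ] (T : X → X) (hT : Ergodic T μ)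
    (d : ℕ) [Fact (1 ≤ (d : ℝ≥0∞))] (hd : 2 ≤ d)
    (e : ℕ → Lp 𝕜 d μ) (he_zero : ∀ᵐ x ∂μ, e 0 x = 1)
    (he_norm : ∀ k, 1 ≤ k → ‖e k‖ = 1) (he_mean : ∀ k, 1 ≤ k → ∫ x, e k x ∂μ = 0)
    (f : Lp 𝕜 d (VonMises.powMeasure μ d))
    (lam : (Fin d → ℕ) → 𝕜) (hlam : Summable fun k => ‖lam k‖)
    (hf : ∀ᵐ x ∂VonMises.powMeasure μ d,
      HasSum (fun k : Fin d → ℕ => lam k * ∏ i, e (k i) (x i)) (f x)) :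
    (∃ u : VonMises.ProjPower 𝕜 d μ d, VonMises.toKernel 𝕜 μ d u = f) ∧
    ∀ u : VonMises.ProjPower 𝕜 d μ d, VonMises.toKernel 𝕜 μ d u = f →
      (∀ᵐ x ∂μ, Tendsto (fun n : ℕ => VonMises.vonMisesAverage hT.toMeasurePreserving u n x) atTop
        (𝓝 (∫ y, f y ∂VonMises.powMeasure μ d))) ∧
      Tendsto (fun n : ℕ => VonMises.vonMisesAverage hT.toMeasurePreserving u n) atTop
        (𝓝 (Lp.const 1 μ (∫ y, f y ∂VonMises.powMeasure μ d))) := by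
  -- All `e k` have norm one, the constant `e 0` because `μ` is a probability measure, so
  -- summability of `lam` is summability of the norms of the tensors.
  have he : ∀ k, ‖e k‖ = 1 := fun k => by
    rcases Nat.eq_zero_or_pos k with rfl | hk
    · have h0 : e 0 = Lp.const d μ (1 : 𝕜) := Lp.ext (by
        filter_upwards [he_zero, Lp.coeFn_const (d : ℝ≥0∞) μ (1 : 𝕜)] with x h1 h2
        rw [h1, h2, Function.const_apply])
      rw [h0, Lp.norm_const' (d : ℝ≥0∞) μ (1 : 𝕜) (by simp; omega) (by simp)]
      simp
    · exact he_norm k hk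
  have hs : Summable fun k : Fin d → ℕ => ‖lam k‖ * ∏ i, ‖e (k i)‖ := by simpa [he] using hlam
  refine ⟨VonMises.exists_toKernel_eq (c := lam) (g := fun k i => e (k i)) hs hf, ?_⟩
  rintro u rfl
  exact VonMises.tendsto_vonMisesAverage hT hd u
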